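/- Let $d_{i,j}\in[0,1]$, $(i,j)\in\{0,\pm1\}^2$, be weights with $\sum_{i,j}d_{i,j}=1$, let $\mathcal S=\{(i,j)\in\{0,\pm1\}^2 : d_{i,j}\neq0\}$ be the corresponding model (step set), and let $t\in\,]0,1[$ be transcendental over $\mathbb Q(d_{i,j})$. Consider the bihomogeneous kernel polynomial $$\overline K(x_0,x_1,y_0,y_1,t)=x_0x_1y_0y_1-t\sum_{i,j=0}^{2}d_{i-1,j-1}\,x_0^{i}x_1^{2-i}y_0^{j}y_1^{2-j}=\overline A_2x_0^2+\overline B_2x_0x_1+\overline C_2x_1^2,$$ with $\overline A_2,\overline B_2,\overline C_2\in\mathbb C[y_0,y_1]$, and let $\Delta_2=\overline B_2^{\,2}-4\overline A_2\overline C_2\in\mathbb C[y_0,y_1]$ be its discriminant with respect to $(x_0,x_1)$, a binary quartic form. Then $\Delta_2$ has a double zero in $\mathbb P^1(\mathbb C)$ (a point $[a:b]$ such that $(by_0-ay_1)^2$ divides $\Delta_2$) if and only if $\mathcal S$ is contained in a closed half-plane whose boundary passes through $(0,0)$. Moreover, $\mathcal S$ is contained in such a half-plane if and only if $\mathcal S\setminus\{(0,0)\}$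 is contained in at least one of the following eight sets: 1. $\{(0,1),(1,1),(1,0),(1,-1),(0,-1)\}$, 2. $\{(-1,1),(0,1),(1,1),(1,0),(1,-1)\}$, 3. $\{(-1,1),(0,1),(1,1),(-1,0),(1,0)\}$, 4. $\{(-1,1),(1,1),(-1,0),(0,1),(-1,-1)\}$, 5. $\{(-1,1),(0,1),(-1,0),(-1,-1),(0,-1)\}$, 6. $\{(-1,1),(-1,0),(-1,-1),(0,-1),(1,-1)\}$, 7. $\{(-1,0),(1,0),(-1,-1),(0,-1),(1,-1)\}$, 8. $\{(1,1),(1,0),(-1,-1),(0,-1),(1,-1)\}$. -/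

import Mathlib

open scoped LinearAlgebra.Projectivization

noncomputable section

namespace KernelCurve

/-- The nine small steps `{0, ±1}²`. -/
def smallSteps : Finset (ℤ × ℤ) := Finset.Icc (-1) 1 ×ˢ Finset.Icc (-1) 1

/-- `d` is a family of step weights: `d i j ∈ [0, 1]` for `(i, j) ∈ {0, ±1}²`, with total weight `1`.
(The values of `d` outside `{0, ±1}²` play no role anywhere.) -/
def IsWeight (d : ℤ → ℤ → ℝ) : Prop :=
  (∀ s ∈ smallSteps, d s.1 s.2 ∈ Set.Icc (0 : ℝ) 1) ∧ ∑ s ∈ smallSteps, d s.1 s.2 = 1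

/-- The step set (or model): the steps of nonzero weight. -/
def stepSet (d : ℤ → ℤ → ℝ) : Set (ℤ × ℤ) := {s | s ∈ smallSteps ∧ d s.1 s.2 ≠ 0}

/-- The field `ℚ(d_{i,j})`, as a subfield of `ℝ`. -/
def weightField (d : ℤ → ℤ → ℝ) : IntermediateField ℚ ℝ :=
  IntermediateField.adjoin ℚ {r : ℝ | ∃ s ∈ smallSteps, r = d s.1 s.2}

/-- The bihomogeneous kernel
`K̄(x₀, x₁, y₀, y₁, t) = x₀ x₁ y₀ y₁ - t ∑_{i,j=0}^{2} d_{i-1,j-1} x₀ⁱ x₁²⁻ⁱ y₀ʲ y₁²⁻ʲ`,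
with arguments in an arbitrary commutative real algebra. -/
def kernelBar {R : Type*} [CommRing R] [Algebra ℝ R] (d : ℤ → ℤ → ℝ) (t : ℝ)
    (x₀ x₁ y₀ y₁ : R) : R :=
  x₀ * x₁ * y₀ * y₁ - algebraMap ℝ R t *
    ∑ i ∈ Finset.range 3, ∑ j ∈ Finset.range 3,
      algebraMap ℝ R (d ((i : ℤ) - 1) ((j : ℤ) - 1)) *
        x₀ ^ i * x₁ ^ (2 - i) * y₀ ^ j * y₁ ^ (2 - j)

/-- The homogeneous kernel is `x₁² y₁² K(x₀/x₁, y₀/y₁, t)`, where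
`K(x, y, t) = x y (1 - t ∑ d_{i,j} xⁱ yʲ)`. -/
theorem kernelBar_eq (d : ℤ → ℤ → ℝ) (t : ℝ) (x₀ x₁ y₀ y₁ : ℂ)
    (hx₀ : x₀ ≠ 0) (hx₁ : x₁ ≠ 0) (hy₀ : y₀ ≠ 0) (hy₁ : y₁ ≠ 0) :
    kernelBar d t x₀ x₁ y₀ y₁ = x₁ ^ 2 * y₁ ^ 2 * ((x₀ / x₁) * (y₀ / y₁) *
      (1 - (t : ℂ) * ∑ s ∈ smallSteps, (d s.1 s.2 : ℂ) * (x₀ / x₁) ^ s.1 * (y₀ / y₁) ^ s.2)) := by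
  have hI : (Finset.Icc (-1) 1 : Finset ℤ) = {-1, 0, 1} := by decide
  simp [kernelBar, smallSteps, Finset.sum_product, hI, Finset.sum_range_succ]
  field_simp
  ring

/-- `K̄(x, 1, y₀, y₁, t)` as a polynomial in the one variable `x`, with coefficients in
`ℂ[y₀, y₁]` (`y₀ = X 0`, `y₁ = X 1`).  As `K̄` is a quadratic form in `(x₀, x₁)`, the coefficients
of `x₀²`, `x₀ x₁`, `x₁²` in `K̄` are the coefficients of degree `2`, `1`, `0` here. -/
def kernelInX (d : ℤ → ℤ → ℝ) (t : ℝ) : Polynomial (MvPolynomial (Fin 2) ℂ) :=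
  kernelBar d t Polynomial.X 1
    (Polynomial.C (MvPolynomial.X 0)) (Polynomial.C (MvPolynomial.X 1))

/-- `Δ₂ = B̄₂² - 4 Ā₂ C̄₂ ∈ ℂ[y₀, y₁]`: the discriminant of the binary quadratic form
`Ā₂ x₀² + B̄₂ x₀ x₁ + C̄₂ x₁² = K̄(x₀, x₁, y₀, y₁, t)`; a binary quartic form. -/
def discr₂ (d : ℤ → ℤ → ℝ) (t : ℝ) : MvPolynomial (Fin 2) ℂ :=
  (kernelInX d t).coeff 1 ^ 2 - 4 * (kernelInX d t).coeff 2 * (kernelInX d t).coeff 0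

/-- The point `p = [a : b]` of the complex projective line is a double zero of the binary form `F`:
it is a zero of multiplicity at least two, i.e. `F` is divisible by the square of the linear form
`b y₀ - a y₁`. -/
def IsDoubleZero (F : MvPolynomial (Fin 2) ℂ) (p : ℙ ℂ (Fin 2 → ℂ)) : Prop :=
  (MvPolynomial.C (p.rep 1) * MvPolynomial.X 0 - MvPolynomial.C (p.rep 0) * MvPolynomial.X 1) ^ 2
    ∣ F

/-- A set of steps is contained in a closed half-plane whose boundary passes through the origin. -/
def InClosedHalfPlane (S : Set (ℤ × ℤ)) : Prop :=
  ∃ a b : ℝ, (a, b) ≠ (0, 0) ∧ ∀ s ∈ S, 0 ≤ a * (s.1 : ℝ) + b * (s.2 : ℝ)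

/-- The eight families of models, each given by its allowed nonzero steps. -/
def family : Fin 8 → Finset (ℤ × ℤ) :=
  ![{(0, 1), (1, 1), (1, 0), (1, -1), (0, -1)},
    {(-1, 1), (0, 1), (1, 1), (1, 0), (1, -1)},
    {(-1, 1), (0, 1), (1, 1), (-1, 0), (1, 0)},
    {(-1, 1), (1, 1), (-1, 0), (0, 1), (-1, -1)},
    {(-1, 1), (0, 1), (-1, 0), (-1, -1), (0, -1)},
    {(-1, 1), (-1, 0), (-1, -1), (0, -1), (1, -1)},
    {(-1, 0), (1, 0), (-1, -1), (0, -1), (1, -1)},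
    {(1, 1), (1, 0), (-1, -1), (0, -1), (1, -1)}]

/-- The model `S` belongs to the `k`-th family: each of its steps is an allowed step of the family
(none of them has to occur) or the zero step, on which nothing is assumed. -/
def InFamily (S : Set (ℤ × ℤ)) (k : Fin 8) : Prop :=
  ∀ s ∈ S, s = (0, 0) ∨ s ∈ family k

/-- Being a double zero does not depend on the homogeneous coordinates. -/
theorem isDoubleZero_mk (F : MvPolynomial (Fin 2) ℂ) (v : Fin 2 → ℂ) (hv : v ≠ 0) :
    IsDoubleZero F (Projectivization.mk ℂ v hv) ↔
      (MvPolynomial.C (v 1) * MvPolynomial.X 0 - MvPolynomial.C (v 0) * MvPolynomial.X 1) ^ 2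
        ∣ F := by
  obtain ⟨c, hc⟩ := Projectivization.exists_smul_eq_mk_rep ℂ v hv
  have hu : IsUnit ((MvPolynomial.C (c : ℂ) : MvPolynomial (Fin 2) ℂ) ^ 2) :=
    ((c.isUnit).map MvPolynomial.C).pow 2
  have h : (MvPolynomial.C ((Projectivization.mk ℂ v hv).rep 1) * MvPolynomial.X 0 -
      MvPolynomial.C ((Projectivization.mk ℂ v hv).rep 0) * MvPolynomial.X 1 :
        MvPolynomial (Fin 2) ℂ) ^ 2 = MvPolynomial.C (c : ℂ) ^ 2 *
      (MvPolynomial.C (v 1) * MvPolynomial.X 0 - MvPolynomial.C (v 0) * MvPolynomial.X 1) ^ 2 := by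
    rw [← hc]
    simp only [Pi.smul_apply, Units.smul_def, smul_eq_mul, map_mul]
    ring
  rw [IsDoubleZero, h, hu.mul_left_dvd]

/-- The explicit form of `Δ₂`. -/
theorem discr₂_eq (d : ℤ → ℤ → ℝ) (t : ℝ) (y₀ y₁ : ℂ) (ht : t ≠ 0) :
    MvPolynomial.eval ![y₀, y₁] (discr₂ d t) = (t : ℂ) ^ 2 *
      ((d 0 (-1) * y₁ ^ 2 - 1 / (t : ℂ) * y₀ * y₁ + d 0 0 * y₀ * y₁ + d 0 1 * y₀ ^ 2) ^ 2
        - 4 * (d 1 (-1) * y₁ ^ 2 + d 1 0 * y₀ * y₁ + d 1 1 * y₀ ^ 2) *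
            (d (-1) (-1) * y₁ ^ 2 + d (-1) 0 * y₀ * y₁ + d (-1) 1 * y₀ ^ 2)) := by
  have ht' : (t : ℂ) ≠ 0 := by exact_mod_cast ht
  have hK : kernelInX d t =
      Polynomial.C (-(MvPolynomial.C (t : ℂ) * (MvPolynomial.C (d (-1) (-1) : ℂ) *
        MvPolynomial.X 1 ^ 2 + MvPolynomial.C (d (-1) 0 : ℂ) * MvPolynomial.X 0 * MvPolynomial.X 1
        + MvPolynomial.C (d (-1) 1 : ℂ) * MvPolynomial.X 0 ^ 2))) +
      Polynomial.C (MvPolynomial.X 0 * MvPolynomial.X 1 -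
        (MvPolynomial.C (t : ℂ) * (MvPolynomial.C (d 0 (-1) : ℂ) *
        MvPolynomial.X 1 ^ 2 + MvPolynomial.C (d 0 0 : ℂ) * MvPolynomial.X 0 * MvPolynomial.X 1
        + MvPolynomial.C (d 0 1 : ℂ) * MvPolynomial.X 0 ^ 2))) * Polynomial.X +
      Polynomial.C (-(MvPolynomial.C (t : ℂ) * (MvPolynomial.C (d 1 (-1) : ℂ) *
        MvPolynomial.X 1 ^ 2 + MvPolynomial.C (d 1 0 : ℂ) * MvPolynomial.X 0 * MvPolynomial.X 1
        + MvPolynomial.C (d 1 1 : ℂ) * MvPolynomial.X 0 ^ 2))) * Polynomial.X ^ 2 := by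
    have ha : ∀ r : ℝ, algebraMap ℝ (Polynomial (MvPolynomial (Fin 2) ℂ)) r =
        Polynomial.C (MvPolynomial.C (r : ℂ)) := fun r => rfl
    simp only [kernelInX, kernelBar, Finset.sum_range_succ, Finset.sum_range_zero, ha]
    norm_num
    ring
  have hc : ∀ a b c : MvPolynomial (Fin 2) ℂ, ∀ q : Polynomial (MvPolynomial (Fin 2) ℂ),
      q = Polynomial.C a + Polynomial.C b * Polynomial.X + Polynomial.C c * Polynomial.X ^ 2 →
      q.coeff 0 = a ∧ q.coeff 1 = b ∧ q.coeff 2 = c := by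
    rintro a b c q rfl
    simp only [Polynomial.coeff_add, Polynomial.coeff_C_mul, Polynomial.coeff_C,
      Polynomial.coeff_X, Polynomial.coeff_X_pow]
    norm_num
  obtain ⟨h0, h1, h2⟩ := hc _ _ _ _ hK
  rw [discr₂, h0, h1, h2]
  simp
  field_simp
  ring

end KernelCurve

end

/-! Put y = y₀/y₁. Up to the factor y₁⁴, Δ₂ is D(y) = (y - tB)² - 4t²AC, where A, B, C are
quadratics in y with nonnegative coefficients, the weights of the steps with i = 1, 0, -1.

If the model lies in a family, either A or C vanishes, so Δ₂ is the square of a quadratic form, or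
the two lowest or two highest coefficients of Δ₂ vanish, giving a double zero at [0:1] or [1:0].

Otherwise, D(±1) > 0 and a sign argument yields two distinct real roots in (-1, 1)
(`exists_two_roots`). Exchanging y₀ and y₁ yields two more with |y| > 1 or at infinity. Four
distinct zeros exhaust a nonzero quartic form, so none is double (`quartic_eq_prod`,
`not_sq_dvd_prod`).

The half-plane criterion is a case split on the octant of the normal vector. -/

namespace KernelCurve

/-! ### Real roots in (-1, 1) -/

/-- The dehomogenized discriminant `(y - t b(y))² - 4 t² a(y) c(y)` is positive at `1` and `-1`. -/
theorem discr_pos_at_one {t a b c a' b' c' : ℝ} (ht0 : 0 < t) (ht1 : t < 1)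
    (hsum : a + b + c = 1) (ha : |a'| ≤ a) (hb : |b'| ≤ b) (hc : |c'| ≤ c) :
    0 < (1 - t * b') ^ 2 - 4 * t ^ 2 * a' * c' := by
  have ha0 := (abs_nonneg _).trans ha
  have hc0 := (abs_nonneg _).trans hc
  have hb1 : b' ≤ b := (le_abs_self _).trans hb
  -- This is t(a + b + c) = t < 1; the rest is (a + c)² ≥ 4ac.
  have h1 : t * (a + c) < 1 - t * b' := by nlinarith
  have h2 : (t * (a + c)) ^ 2 < (1 - t * b') ^ 2 :=
    pow_lt_pow_left₀ h1 (by positivity) two_ne_zero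
  have h3 : a' * c' ≤ a * c := by
    refine (le_abs_self _).trans ?_
    rw [abs_mul]
    exact mul_le_mul ha hc (abs_nonneg _) ha0
  have h4 : t ^ 2 * (a' * c') ≤ t ^ 2 * (a * c) := by gcongr
  nlinarith [sq_nonneg (t * (a - c))]

/-- A continuous function that is negative at `x` and positive at `y` vanishes in between. -/
theorem exists_zero_Ioo {f : ℝ → ℝ} (hf : Continuous f) {x y : ℝ} (hxy : x < y)
    (hx : f x < 0) (hy : 0 < f y) : ∃ z, x < z ∧ z < y ∧ f z = 0 := by
  obtain ⟨z, ⟨h1, h2⟩, h⟩ := intermediate_value_Ioo hxy.le hf.continuousOn ⟨hx, hy⟩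
  exact ⟨z, h1, h2, h⟩

/-- The dehomogenized discriminant has two distinct roots in `(-1, 1)` as soon as neither `a` nor
`c` vanishes and the coefficients near `y = 0` are not too degenerate. -/
theorem exists_two_roots {t a₀ a₁ a₂ b₀ b₁ b₂ c₀ c₁ c₂ : ℝ} (ht0 : 0 < t) (ht1 : t < 1)
    (ha₀ : 0 ≤ a₀) (ha₁ : 0 ≤ a₁) (ha₂ : 0 ≤ a₂) (hb₀ : 0 ≤ b₀) (hb₁ : 0 ≤ b₁) (hb₂ : 0 ≤ b₂)
    (hc₀ : 0 ≤ c₀) (hc₁ : 0 ≤ c₁) (hc₂ : 0 ≤ c₂)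
    (hsum : (a₀ + a₁ + a₂) + (b₀ + b₁ + b₂) + (c₀ + c₁ + c₂) = 1)
    (ha : 0 < a₀ + a₁ + a₂) (hc : 0 < c₀ + c₁ + c₂)
    (h0 : 0 < b₀ ∨ 0 < a₀ * c₀ ∨ 0 < a₀ * c₁ + a₁ * c₀) :
    ∃ u v : ℝ, u ≠ v ∧ |u| < 1 ∧ |v| < 1 ∧ ∀ y, y = u ∨ y = v →
      (y - t * (b₀ + b₁ * y + b₂ * y ^ 2)) ^ 2
        - 4 * t ^ 2 * (a₀ + a₁ * y + a₂ * y ^ 2) * (c₀ + c₁ * y + c₂ * y ^ 2) = 0 := by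
  set A : ℝ → ℝ := fun y => a₀ + a₁ * y + a₂ * y ^ 2 with hA
  set B : ℝ → ℝ := fun y => b₀ + b₁ * y + b₂ * y ^ 2 with hB
  set C : ℝ → ℝ := fun y => c₀ + c₁ * y + c₂ * y ^ 2 with hC
  set D : ℝ → ℝ := fun y => (y - t * B y) ^ 2 - 4 * t ^ 2 * A y * C y with hD
  set S : ℝ → ℝ := fun y => √(A y * C y) with hS
  set P : ℝ → ℝ := fun y => y - t * B y - 2 * t * S y with hP
  set M : ℝ → ℝ := fun y => y - t * B y + 2 * t * S y with hM
  suffices ∃ u v : ℝ, u ≠ v ∧ |u| < 1 ∧ |v| < 1 ∧ D u = 0 ∧ D v = 0 by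
    obtain ⟨u, v, huv, hu, hv, hDu, hDv⟩ := this
    exact ⟨u, v, huv, hu, hv, by rintro y (rfl | rfl) <;> assumption⟩
  have hDc : Continuous D := by fun_prop
  have hPc : Continuous P := by fun_prop
  have hMc : Continuous M := by fun_prop
  have hS2 : ∀ y, 0 ≤ y → S y ^ 2 = A y * C y := fun y hy =>
    Real.sq_sqrt (by simp only [hA, hC]; positivity)
  have hfac : ∀ y, 0 ≤ y → D y = P y * M y := fun y hy => by
    have := hS2 y hy
    simp only [hD, hP, hM]
    linear_combination 4 * t ^ 2 * this
  have hD1 : 0 < D 1 := by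
    have := discr_pos_at_one ht0 ht1 hsum (abs_of_pos ha).le (abs_of_nonneg
      (by positivity : 0 ≤ b₀ + b₁ + b₂)).le (abs_of_pos hc).le
    simpa [hD, hA, hB, hC] using this
  have hDm : 0 < D (-1) := by
    have := discr_pos_at_one (a' := a₀ - a₁ + a₂) (b' := -(b₀ - b₁ + b₂)) (c' := c₀ - c₁ + c₂)
      ht0 ht1 hsum (abs_le.2 ⟨by linarith, by linarith⟩) (abs_le.2 ⟨by linarith, by linarith⟩)
      (abs_le.2 ⟨by linarith, by linarith⟩)
    convert this using 1
    simp only [hD, hA, hB, hC]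
    ring
  have hS1 : 0 ≤ S 1 := Real.sqrt_nonneg _
  have hS0 : 0 ≤ S 0 := Real.sqrt_nonneg _
  have hM1 : 0 < M 1 := by
    have : t * (b₀ + b₁ + b₂) < 1 := by nlinarith
    have h2 : 0 ≤ 2 * t * S 1 := by positivity
    simp only [hM, hB]
    linarith
  have hP1 : 0 < P 1 := by
    rw [hfac 1 zero_le_one] at hD1
    exact (pos_iff_pos_of_mul_pos hD1).2 hM1
  have hroot : ∀ x, 0 ≤ x → x < 1 → P x < 0 → ∃ z, x < z ∧ z < 1 ∧ P z = 0 :=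
    fun x _ hx1 hx => exists_zero_Ioo hPc hx1 hx hP1
  have habs : ∀ z : ℝ, 0 ≤ z → z < 1 → |z| < 1 := fun z h h' => by rwa [abs_of_nonneg h]
  -- If D(0) < 0 there is a root on each side of 0. If D(0) = 0, a second root comes from P. If D(0)
  -- > 0, P and M each change sign on (0, 1).
  rcases lt_trichotomy (D 0) 0 with hD0 | hD0 | hD0
  · obtain ⟨u, hu0, hu1, hu⟩ := exists_zero_Ioo hDc one_pos hD0 hD1
    obtain ⟨v, hv0, hv1, hv⟩ := exists_zero_Ioo (f := fun y => D (-y)) (by fun_prop) one_pos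
      (by simpa using hD0) hDm
    exact ⟨u, -v, by intro h; linarith, habs u hu0.le hu1,
      by simpa using habs v hv0.le hv1, hu, hv⟩
  · have hneg : ∃ x, 0 ≤ x ∧ x < 1 ∧ P x < 0 := by
      have h00 : (t * b₀) ^ 2 = 4 * t ^ 2 * (a₀ * c₀) := by
        simp [hD, hA, hB, hC] at hD0
        linarith
      rcases hb₀.eq_or_lt with hb | hb
      · have hac : a₀ * c₀ = 0 := by
          rw [← hb] at h00
          have : 4 * t ^ 2 ≠ 0 := by positivity
          simpa [this, ht0.ne'] using h00.symm
        have hk : 0 < a₀ * c₁ + a₁ * c₀ := by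
          rcases h0 with h | h | h
          · exact absurd h (by simp [← hb])
          · exact absurd h (by simp [hac])
          · exact h
        set k := a₀ * c₁ + a₁ * c₀
        -- Since S(x)² ≥ kx, the term 2tS(x) exceeds x as soon as x < 4t²k.
        obtain ⟨x, hx0, hx⟩ := exists_between (lt_min one_pos (by positivity : 0 < 4 * t ^ 2 * k))
        obtain ⟨hx1, hxk⟩ := lt_min_iff.1 hx
        refine ⟨x, hx0.le, hx1, ?_⟩
        have hkx : k * x ≤ S x ^ 2 := by
          rw [hS2 x hx0.le]
          have : 0 ≤ (a₀ * c₂ + a₁ * c₁ + a₂ * c₀) * x ^ 2 + (a₁ * c₂ + a₂ * c₁) * x ^ 3 +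
            a₂ * c₂ * x ^ 4 := by positivity
          simp only [hA, hC, k]
          linear_combination this - hac
        have hlt : x < 2 * t * S x := by
          refine lt_of_pow_lt_pow_left₀ 2 (by positivity) ?_
          calc x ^ 2 = x * x := sq x
            _ < 4 * t ^ 2 * k * x := by gcongr
            _ = 4 * t ^ 2 * (k * x) := by ring
            _ ≤ 4 * t ^ 2 * S x ^ 2 := by gcongr
            _ = _ := by ring
        have hBx : 0 ≤ t * B x := by simp only [hB]; positivity
        simp only [hP]
        linarith
      · refine ⟨0, le_rfl, one_pos, ?_⟩
        have h1 : 0 < t * b₀ := by positivity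
        have h2 : 0 ≤ 2 * t * S 0 := by positivity
        simp only [hP, hB]
        linarith
    obtain ⟨x, hx0, hx1, hx⟩ := hneg
    obtain ⟨z, hz0, hz1, hz⟩ := hroot x hx0 hx1 hx
    exact ⟨0, z, (hx0.trans_lt hz0).ne, by simp, habs z (hx0.trans hz0.le) hz1, hD0,
      by rw [hfac z (hx0.trans hz0.le), hz, zero_mul]⟩
  · have hM0 : M 0 < 0 := by
      have h1 : 4 * t ^ 2 * S 0 ^ 2 < (t * b₀) ^ 2 := by
        rw [hS2 0 le_rfl]
        simp [hD, hA, hB, hC] at hD0 ⊢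
        linarith
      have h2 : 2 * t * S 0 < t * b₀ :=
        lt_of_pow_lt_pow_left₀ 2 (by positivity) (by linarith)
      simp only [hM, hB]
      linarith
    have hP0 : P 0 < 0 := by
      have : 0 ≤ 2 * t * S 0 := by positivity
      simp only [hP, hM] at hM0 ⊢
      linarith
    obtain ⟨u, hu0, hu1, hu⟩ := hroot 0 le_rfl one_pos hP0
    obtain ⟨v, hv0, hv1, hv⟩ := exists_zero_Ioo hMc one_pos hM0 hM1
    refine ⟨u, v, ?_, habs u hu0.le hu1, habs v hv0.le hv1, by rw [hfac u hu0.le, hu, zero_mul],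
      by rw [hfac v hv0.le, hv, mul_zero]⟩
    -- A common root of P and M would force S(u) = 0, but A and C are positive for u > 0.
    rintro rfl
    have hpos : ∀ p q r : ℝ, 0 ≤ p → 0 ≤ q → 0 ≤ r → 0 < p + q + r →
        0 < p + q * u + r * u ^ 2 := by
      intro p q r hp hq hr h
      rcases hp.eq_or_lt with hp | hp
      · rcases hq.eq_or_lt with hq | hq
        · have : 0 < r := by linarith
          positivity
        · positivity
      · positivity
    have hSu : 0 < S u := Real.sqrt_pos.2
      (mul_pos (hpos _ _ _ ha₀ ha₁ ha₂ ha) (hpos _ _ _ hc₀ hc₁ hc₂ hc))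
    have : 0 < t * S u := by positivity
    simp only [hP, hM] at hu hv
    linarith

/-! ### Quartic forms with four distinct zeros -/

/-- A binary quartic form with two distinct zeros `[u : 1]` in the unit disc and two distinct
zeros `[1 : v]` in the unit disc around infinity is a product of four linear forms. -/
theorem quartic_eq_prod {e₀ e₁ e₂ e₃ e₄ u u' v v' : ℝ} (huu : u ≠ u') (hvv : v ≠ v')
    (hu : |u| < 1) (hu' : |u'| < 1) (hv : |v| < 1) (hv' : |v'| < 1)
    (h : ∀ y, y = u ∨ y = u' → e₀ + e₁ * y + e₂ * y ^ 2 + e₃ * y ^ 3 + e₄ * y ^ 4 = 0)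
    (h' : ∀ y, y = v ∨ y = v' → e₄ + e₃ * y + e₂ * y ^ 2 + e₁ * y ^ 3 + e₀ * y ^ 4 = 0) :
    ∃ k : ℝ, ∀ y₀ y₁ : ℂ,
      e₀ * y₁ ^ 4 + e₁ * y₀ * y₁ ^ 3 + e₂ * y₀ ^ 2 * y₁ ^ 2 + e₃ * y₀ ^ 3 * y₁ + e₄ * y₀ ^ 4 =
        k * (y₀ - u * y₁) * (y₀ - u' * y₁) * (y₁ - v * y₀) * (y₁ - v' * y₀) := by
  have hne : ∀ x y : ℝ, |x| < 1 → |y| < 1 → 1 - x * y ≠ 0 := by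
    intro x y hx hy h
    have h1 : |x * y| < 1 := by
      rw [abs_mul]
      exact mul_lt_one_of_nonneg_of_lt_one_left (abs_nonneg _) hx hy.le
    have h2 : x * y = 1 := by linarith
    simp [h2] at h1
  have g1 := h u (.inl rfl)
  have g2 := h u' (.inr rfl)
  have e1 : e₁ + e₂ * (u + u') + e₃ * (u ^ 2 + u * u' + u' ^ 2) +
      e₄ * (u ^ 3 + u ^ 2 * u' + u * u' ^ 2 + u' ^ 3) = 0 := by
    refine mul_left_cancel₀ (sub_ne_zero.2 huu) ?_
    linear_combination g1 - g2
  -- The quotient of the quartic by (y - u)(y - u') is e₄y² + ly + k; its reversal must vanish at v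
  -- and v', because 1 - uy and 1 - u'y do not.
  set k := e₂ + e₃ * (u + u') + e₄ * (u ^ 2 + u * u' + u' ^ 2) with hk
  set l := e₃ + e₄ * (u + u') with hl
  have hQ : ∀ y, y = v ∨ y = v' → k * y ^ 2 + l * y + e₄ = 0 := by
    intro y hy
    have hy1 : |y| < 1 := by rcases hy with rfl | rfl <;> assumption
    refine mul_left_cancel₀ (mul_ne_zero (hne u y hu hy1) (hne u' y hu' hy1)) ?_
    rw [hk, hl]
    linear_combination h' y hy - y ^ 4 * g1 - (y ^ 3 - u * y ^ 4) * e1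
  have q1 := hQ v (.inl rfl)
  have q2 := hQ v' (.inr rfl)
  have f1 : k * (v + v') + l = 0 := by
    refine mul_left_cancel₀ (sub_ne_zero.2 hvv) ?_
    linear_combination q1 - q2
  have f2 : e₄ = k * (v * v') := by linear_combination q1 - v * f1
  have f3 : l = -k * (v + v') := by linear_combination f1
  have r3 : e₃ = l - e₄ * (u + u') := by rw [hl]; ring
  have r2 : e₂ = k - l * (u + u') + e₄ * (u * u') := by rw [hl, hk]; ring
  have r1 : e₁ = -k * (u + u') + l * (u * u') := by rw [hl, hk]; linear_combination e1
  have r0 : e₀ = k * (u * u') := by rw [hk]; linear_combination g1 - u * e1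
  refine ⟨k, fun y₀ y₁ => ?_⟩
  clear_value k l
  subst f2 f3 r3 r2 r1 r0
  push_cast
  ring

open MvPolynomial in
/-- The square of the linear form through `(p, q)` does not divide a product of four pairwise
nonproportional linear forms. -/
theorem not_sq_dvd_prod {k u u' v v' p q : ℂ} (hk : k ≠ 0) (hpq : p ≠ 0 ∨ q ≠ 0)
    (huu : u ≠ u') (hvv : v ≠ v') (h11 : u * v ≠ 1) (h12 : u * v' ≠ 1) (h21 : u' * v ≠ 1)
    (h22 : u' * v' ≠ 1) :
    ¬ (C q * X 0 - C p * X 1 : MvPolynomial (Fin 2) ℂ) ^ 2 ∣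
      C k * (X 0 - C u * X 1) * (X 0 - C u' * X 1) * (X 1 - C v * X 0) * (X 1 - C v' * X 0) := by
  rintro ⟨G, hG⟩
  -- Divisibility by the square makes the form and both partial derivatives vanish at (p, q). One
  -- factor then vanishes there, and a suitable partial derivative is, up to sign, the product of k
  -- and the other three factors, which is nonzero.
  have z := congrArg (eval ![p, q]) hG
  have z0 := congrArg (fun F => eval ![p, q] (pderiv 0 F)) hG
  have z1 := congrArg (fun F => eval ![p, q] (pderiv 1 F)) hG
  simp only [Derivation.leibniz, Derivation.leibniz_pow, map_sub, map_add, map_mul, map_pow,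
    smul_eq_mul, pderiv_X_self, pderiv_X_of_ne one_ne_zero, pderiv_X_of_ne zero_ne_one, pderiv_C,
    eval_X, eval_C, map_nsmul, map_zero, map_one, Matrix.cons_val_zero, Matrix.cons_val_one,
    mul_comm q p, sub_self] at z z0 z1
  have hq : ∀ w : ℂ, p = w * q → q ≠ 0 := by
    rintro w h rfl
    simp_all
  have hp : ∀ w : ℂ, q = w * p → p ≠ 0 := by
    rintro w h rfl
    simp_all
  have nz : ∀ {x y z : ℂ}, x ≠ 0 → y ≠ 0 → z ≠ 0 → k * x * y * z ≠ 0 := fun hx hy hz =>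
    mul_ne_zero (mul_ne_zero (mul_ne_zero hk hx) hy) hz
  have lin : ∀ {x y w : ℂ}, w ≠ 0 → x ≠ y → x * w - y * w ≠ 0 := fun hw hxy h =>
    hxy (mul_right_cancel₀ hw (sub_eq_zero.1 h))
  have lin' : ∀ {x y w : ℂ}, w ≠ 0 → x * y ≠ 1 → w - y * (x * w) ≠ 0 := fun hw hxy h =>
    hxy (mul_right_cancel₀ hw (by linear_combination -h))
  simp only [ne_eq, OfNat.ofNat_ne_zero, not_false_eq_true, zero_pow, zero_mul, mul_eq_zero, hk,
    false_or, sub_eq_zero] at z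
  rcases z with ((z | z) | z) | z
  · have hw := hq _ z
    rw [z] at z0
    exact nz (lin hw huu) (lin' hw h11) (lin' hw h12) (by linear_combination z0)
  · have hw := hq _ z
    rw [z] at z0
    exact nz (lin hw huu.symm) (lin' hw h21) (lin' hw h22) (by linear_combination z0)
  · have hw := hp _ z
    rw [z] at z1
    rw [mul_comm] at h11 h21
    exact nz (lin' hw h11) (lin' hw h21) (lin hw hvv) (by linear_combination z1)
  · have hw := hp _ z
    rw [z] at z1
    rw [mul_comm] at h12 h22
    exact nz (lin' hw h12) (lin' hw h22) (lin hw hvv.symm) (by linear_combination z1)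

/-! ### Half-planes and the eight families -/

theorem inFamily_stepSet_iff {d : ℤ → ℤ → ℝ} {k : Fin 8} (m : Finset (ℤ × ℤ))
    (hm : smallSteps.filter (fun s => ¬ (s = (0, 0) ∨ s ∈ family k)) = m) :
    InFamily (stepSet d) k ↔ ∀ s ∈ m, d s.1 s.2 = 0 := by
  subst hm
  simp only [InFamily, stepSet, Set.mem_ofPred_eq, Finset.mem_filter, and_imp]
  refine forall_congr' fun s => ?_
  tauto

/-- A normal with angle in [45k°, 45(k+1)°) pairs strictly negatively with the three nonzero steps
outside family k. Conversely, the normal at angle 45k° works for the whole of family k. -/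
theorem inClosedHalfPlane_iff {S : Set (ℤ × ℤ)} (hS : ∀ s ∈ S, s ∈ smallSteps) :
    InClosedHalfPlane S ↔ ∃ k : Fin 8, InFamily S k := by
  have hall : ∀ s ∈ S, s = (-1, -1) ∨ s = (-1, 0) ∨ s = (-1, 1) ∨ s = (0, -1) ∨ s = (0, 0) ∨
      s = (0, 1) ∨ s = (1, -1) ∨ s = (1, 0) ∨ s = (1, 1) := fun s hs =>
    (by decide : ∀ s ∈ smallSteps, s = (-1, -1) ∨ s = (-1, 0) ∨ s = (-1, 1) ∨ s = (0, -1) ∨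
      s = (0, 0) ∨ s = (0, 1) ∨ s = (1, -1) ∨ s = (1, 0) ∨ s = (1, 1)) s (hS s hs)
  constructor
  · rintro ⟨a, b, hab, h⟩
    have key : ∀ (k : Fin 8), (∀ s ∈ smallSteps, ¬ (s = (0, 0) ∨ s ∈ family k) →
        a * (s.1 : ℝ) + b * (s.2 : ℝ) < 0) → ∃ k : Fin 8, InFamily S k := fun k hk =>
      ⟨k, fun s hs => by_contra fun hn => (hk s (hS s hs) hn).not_ge (h s hs)⟩
    have out : ∀ (k : Fin 8) (m : Finset (ℤ × ℤ)),
        smallSteps.filter (fun s => ¬ (s = (0, 0) ∨ s ∈ family k)) = m →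
        (∀ s ∈ m, a * (s.1 : ℝ) + b * (s.2 : ℝ) < 0) → ∃ k : Fin 8, InFamily S k := by
      rintro k _ rfl hk
      exact key k fun s hs hn => hk s (Finset.mem_filter.2 ⟨hs, hn⟩)
    have hab' : a ≠ 0 ∨ b ≠ 0 := by
      by_contra! hn
      exact hab (by simp [hn.1, hn.2])
    rcases lt_trichotomy b 0 with hb | hb | hb
    · rcases lt_or_ge a b with h1 | h1
      · refine out 4 {(1, 1), (1, 0), (1, -1)} (by decide) ?_
        simp; refine ⟨?_, ?_, ?_⟩ <;> linarith
      rcases lt_or_ge a 0 with h2 | h2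
      · refine out 5 {(1, 1), (1, 0), (0, 1)} (by decide) ?_
        simp; refine ⟨?_, ?_, ?_⟩ <;> linarith
      rcases lt_or_ge a (-b) with h3 | h3
      · refine out 6 {(1, 1), (-1, 1), (0, 1)} (by decide) ?_
        simp; refine ⟨?_, ?_, ?_⟩ <;> linarith
      · refine out 7 {(-1, 1), (-1, 0), (0, 1)} (by decide) ?_
        simp; refine ⟨?_, ?_, ?_⟩ <;> linarith
    · subst hb
      rcases lt_trichotomy a 0 with ha | ha | ha
      · refine out 4 {(1, 1), (1, 0), (1, -1)} (by decide) ?_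
        simp; assumption
      · simp [ha] at hab'
      · refine out 0 {(-1, 1), (-1, 0), (-1, -1)} (by decide) ?_
        simp; assumption
    · rcases lt_or_ge b a with h1 | h1
      · refine out 0 {(-1, 1), (-1, 0), (-1, -1)} (by decide) ?_
        simp; refine ⟨?_, ?_, ?_⟩ <;> linarith
      rcases lt_or_ge 0 a with h2 | h2
      · refine out 1 {(-1, -1), (-1, 0), (0, -1)} (by decide) ?_
        simp; refine ⟨?_, ?_, ?_⟩ <;> linarith
      rcases lt_or_ge (-b) a with h3 | h3
      · refine out 2 {(1, -1), (-1, -1), (0, -1)} (by decide) ?_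
        simp; refine ⟨?_, ?_, ?_⟩ <;> linarith
      · refine out 3 {(1, -1), (1, 0), (0, -1)} (by decide) ?_
        simp; refine ⟨?_, ?_, ?_⟩ <;> linarith
  · rintro ⟨k, hk⟩
    have key : ∀ a b : ℤ, (a, b) ≠ (0, 0) →
        (∀ s, s = (0, 0) ∨ s ∈ family k → 0 ≤ a * s.1 + b * s.2) → InClosedHalfPlane S := by
      intro a b hab h
      refine ⟨a, b, by simpa using hab, fun s hs => ?_⟩
      exact_mod_cast h s (hk s hs)
    clear hk
    fin_cases k
    · exact key 1 0 (by decide) (by simp [family])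
    · exact key 1 1 (by decide) (by simp [family])
    · exact key 0 1 (by decide) (by simp [family])
    · exact key (-1) 1 (by decide) (by simp [family])
    · exact key (-1) 0 (by decide) (by simp [family])
    · exact key (-1) (-1) (by decide) (by simp [family])
    · exact key 0 (-1) (by decide) (by simp [family])
    · exact key 1 (-1) (by decide) (by simp [family])

/-! ### Double zeros for models in a family -/

/-- The coefficient of `y₀ⁱ y₁⁴⁻ⁱ` in `Δ₂`. -/
def discrCoeff (d : ℤ → ℤ → ℝ) (t : ℝ) : Fin 5 → ℝ :=
  ![(t * d 0 (-1)) ^ 2 - 4 * t ^ 2 * (d 1 (-1) * d (-1) (-1)),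
    -2 * (1 - t * d 0 0) * (t * d 0 (-1)) -
      4 * t ^ 2 * (d 1 (-1) * d (-1) 0 + d 1 0 * d (-1) (-1)),
    (1 - t * d 0 0) ^ 2 + 2 * (t * d 0 (-1)) * (t * d 0 1) -
      4 * t ^ 2 * (d 1 (-1) * d (-1) 1 + d 1 0 * d (-1) 0 + d 1 1 * d (-1) (-1)),
    -2 * (1 - t * d 0 0) * (t * d 0 1) - 4 * t ^ 2 * (d 1 0 * d (-1) 1 + d 1 1 * d (-1) 0),
    (t * d 0 1) ^ 2 - 4 * t ^ 2 * (d 1 1 * d (-1) 1)]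

theorem eval_discr₂ (d : ℤ → ℤ → ℝ) {t : ℝ} (ht : t ≠ 0) (y₀ y₁ : ℂ) :
    MvPolynomial.eval ![y₀, y₁] (discr₂ d t) =
      discrCoeff d t 0 * y₁ ^ 4 + discrCoeff d t 1 * y₀ * y₁ ^ 3 +
      discrCoeff d t 2 * y₀ ^ 2 * y₁ ^ 2 + discrCoeff d t 3 * y₀ ^ 3 * y₁ +
      discrCoeff d t 4 * y₀ ^ 4 := by
  have ht' : (t : ℂ) ≠ 0 := by exact_mod_cast ht
  rw [discr₂_eq d t y₀ y₁ ht]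
  simp [discrCoeff]
  field_simp
  ring

/-- Binary forms agree as soon as they agree as functions. -/
theorem eq_of_eval_eq {F G : MvPolynomial (Fin 2) ℂ}
    (h : ∀ y₀ y₁ : ℂ, MvPolynomial.eval ![y₀, y₁] F = MvPolynomial.eval ![y₀, y₁] G) : F = G :=
  MvPolynomial.funext fun x => by
    have hx : x = ![x 0, x 1] := by
      ext i
      fin_cases i <;> rfl
    rw [hx, h]

/-- A binary quadratic form over `ℂ` has a zero in the projective line. -/
theorem exists_linear_factor (α β γ : ℂ) : ∃ v : Fin 2 → ℂ, v ≠ 0 ∧ ∃ l m : ℂ, ∀ y₀ y₁ : ℂ,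
    α * y₁ ^ 2 + β * y₀ * y₁ + γ * y₀ ^ 2 = (v 1 * y₀ - v 0 * y₁) * (l * y₀ + m * y₁) := by
  by_cases hγ : γ = 0
  · exact ⟨![1, 0], by simp, -β, -α, fun y₀ y₁ => by simp [hγ]; ring⟩
  · obtain ⟨s, hs⟩ := IsAlgClosed.exists_eq_mul_self (discrim γ β α)
    have hr := (quadratic_eq_zero_iff hγ hs ((-β + s) / (2 * γ))).2 (.inl rfl)
    set r := (-β + s) / (2 * γ)
    refine ⟨![r, 1], by simp, γ, β + γ * r, fun y₀ y₁ => ?_⟩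
    simp
    linear_combination y₁ ^ 2 * hr

theorem exists_isDoubleZero_of_coeff {d : ℤ → ℤ → ℝ} {t : ℝ} (ht : t ≠ 0)
    (h : (discrCoeff d t 0 = 0 ∧ discrCoeff d t 1 = 0) ∨
      (discrCoeff d t 3 = 0 ∧ discrCoeff d t 4 = 0)) :
    ∃ p, IsDoubleZero (discr₂ d t) p := by
  rcases h with ⟨h0, h1⟩ | ⟨h0, h1⟩
  · refine ⟨Projectivization.mk ℂ ![0, 1] (by simp), (isDoubleZero_mk _ _ _).2
      ⟨.C (discrCoeff d t 2 : ℂ) * .X 1 ^ 2 + .C (discrCoeff d t 3 : ℂ) * .X 0 * .X 1 +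
        .C (discrCoeff d t 4 : ℂ) * .X 0 ^ 2, eq_of_eval_eq fun y₀ y₁ => ?_⟩⟩
    rw [eval_discr₂ d ht]
    simp [h0, h1]
    ring
  · refine ⟨Projectivization.mk ℂ ![1, 0] (by simp), (isDoubleZero_mk _ _ _).2
      ⟨.C (discrCoeff d t 0 : ℂ) * .X 1 ^ 2 + .C (discrCoeff d t 1 : ℂ) * .X 0 * .X 1 +
        .C (discrCoeff d t 2 : ℂ) * .X 0 ^ 2, eq_of_eval_eq fun y₀ y₁ => ?_⟩⟩
    rw [eval_discr₂ d ht]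
    simp [h0, h1]
    ring

/-- If the quadratic form has no `x₀²` term or no `x₁²` term, its discriminant is a square. -/
theorem exists_isDoubleZero_of_square {d : ℤ → ℤ → ℝ} {t : ℝ} (ht : t ≠ 0)
    (h : (d 1 (-1) = 0 ∧ d 1 0 = 0 ∧ d 1 1 = 0) ∨
      (d (-1) (-1) = 0 ∧ d (-1) 0 = 0 ∧ d (-1) 1 = 0)) :
    ∃ p, IsDoubleZero (discr₂ d t) p := by
  have ht' : (t : ℂ) ≠ 0 := by exact_mod_cast ht
  obtain ⟨v, hv, l, m, hlm⟩ :=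
    exists_linear_factor (t * d 0 (-1)) (t * d 0 0 - 1) (t * d 0 1)
  refine ⟨Projectivization.mk ℂ v hv, (isDoubleZero_mk _ _ _).2
    ⟨(.C l * .X 0 + .C m * .X 1) ^ 2, eq_of_eval_eq fun y₀ y₁ => ?_⟩⟩
  have hsq : MvPolynomial.eval ![y₀, y₁] (discr₂ d t) =
      (t * d 0 (-1) * y₁ ^ 2 + (t * d 0 0 - 1) * y₀ * y₁ + t * d 0 1 * y₀ ^ 2) ^ 2 := by
    rw [discr₂_eq d t y₀ y₁ ht]
    rcases h with ⟨h1, h2, h3⟩ | ⟨h1, h2, h3⟩ <;>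
    · simp [h1, h2, h3]
      field_simp
      ring
  rw [hsq, hlm]
  simp
  ring

theorem exists_isDoubleZero_of_inFamily {d : ℤ → ℤ → ℝ} {t : ℝ} (ht : t ≠ 0) {k : Fin 8}
    (hk : InFamily (stepSet d) k) : ∃ p, IsDoubleZero (discr₂ d t) p := by
  fin_cases k
  · have := (inFamily_stepSet_iff {(-1, -1), (-1, 0), (-1, 1)} (by decide)).1 hk
    exact exists_isDoubleZero_of_square ht (.inr (by simpa using this))
  · have := (inFamily_stepSet_iff {(-1, -1), (-1, 0), (0, -1)} (by decide)).1 hk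
    simp at this
    exact exists_isDoubleZero_of_coeff ht (.inl (by simp [discrCoeff, this]))
  · have := (inFamily_stepSet_iff {(-1, -1), (1, -1), (0, -1)} (by decide)).1 hk
    simp at this
    exact exists_isDoubleZero_of_coeff ht (.inl (by simp [discrCoeff, this]))
  · have := (inFamily_stepSet_iff {(1, -1), (1, 0), (0, -1)} (by decide)).1 hk
    simp at this
    exact exists_isDoubleZero_of_coeff ht (.inl (by simp [discrCoeff, this]))
  · have := (inFamily_stepSet_iff {(1, -1), (1, 0), (1, 1)} (by decide)).1 hk
    exact exists_isDoubleZero_of_square ht (.inl (by simpa using this))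
  · have := (inFamily_stepSet_iff {(1, 1), (1, 0), (0, 1)} (by decide)).1 hk
    simp at this
    exact exists_isDoubleZero_of_coeff ht (.inr (by simp [discrCoeff, this]))
  · have := (inFamily_stepSet_iff {(1, 1), (-1, 1), (0, 1)} (by decide)).1 hk
    simp at this
    exact exists_isDoubleZero_of_coeff ht (.inr (by simp [discrCoeff, this]))
  · have := (inFamily_stepSet_iff {(-1, 1), (-1, 0), (0, 1)} (by decide)).1 hk
    simp at this
    exact exists_isDoubleZero_of_coeff ht (.inr (by simp [discrCoeff, this]))

/-! ### No double zero outside the families -/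

/-- Excluding families 0 and 4 makes C and A nonzero; excluding 1, 2, 3 gives the nondegeneracy at y
= 0, and 5, 6, 7 the one at infinity. -/
theorem not_isDoubleZero_of_not_inFamily {d : ℤ → ℤ → ℝ} (hd : IsWeight d) {t : ℝ}
    (ht0 : 0 < t) (ht1 : t < 1) (hk : ∀ k, ¬ InFamily (stepSet d) k)
    (p : ℙ ℂ (Fin 2 → ℂ)) : ¬ IsDoubleZero (discr₂ d t) p := by
  obtain ⟨hpos, hsum⟩ := hd
  have hI : (Finset.Icc (-1) 1 : Finset ℤ) = {-1, 0, 1} := by decide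
  simp [smallSteps, Finset.sum_product, hI] at hsum
  have hp : ∀ s ∈ smallSteps, 0 ≤ d s.1 s.2 := fun s hs => (hpos s hs).1
  have p1 : 0 ≤ d (-1) (-1) := hp (-1, -1) (by decide)
  have p2 : 0 ≤ d (-1) 0 := hp (-1, 0) (by decide)
  have p3 : 0 ≤ d (-1) 1 := hp (-1, 1) (by decide)
  have p4 : 0 ≤ d 0 (-1) := hp (0, -1) (by decide)
  have p5 : 0 ≤ d 0 0 := hp (0, 0) (by decide)
  have p6 : 0 ≤ d 0 1 := hp (0, 1) (by decide)
  have p7 : 0 ≤ d 1 (-1) := hp (1, -1) (by decide)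
  have p8 : 0 ≤ d 1 0 := hp (1, 0) (by decide)
  have p9 : 0 ≤ d 1 1 := hp (1, 1) (by decide)
  have k0 := (inFamily_stepSet_iff {(-1, -1), (-1, 0), (-1, 1)} (by decide)).not.1 (hk 0)
  have k1 := (inFamily_stepSet_iff {(-1, -1), (-1, 0), (0, -1)} (by decide)).not.1 (hk 1)
  have k2 := (inFamily_stepSet_iff {(-1, -1), (1, -1), (0, -1)} (by decide)).not.1 (hk 2)
  have k3 := (inFamily_stepSet_iff {(1, -1), (1, 0), (0, -1)} (by decide)).not.1 (hk 3)
  have k4 := (inFamily_stepSet_iff {(1, -1), (1, 0), (1, 1)} (by decide)).not.1 (hk 4)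
  have k5 := (inFamily_stepSet_iff {(1, 1), (1, 0), (0, 1)} (by decide)).not.1 (hk 5)
  have k6 := (inFamily_stepSet_iff {(1, 1), (-1, 1), (0, 1)} (by decide)).not.1 (hk 6)
  have k7 := (inFamily_stepSet_iff {(-1, 1), (-1, 0), (0, 1)} (by decide)).not.1 (hk 7)
  simp only [Finset.mem_insert, Finset.mem_singleton, forall_eq_or_imp, forall_eq]
    at k0 k1 k2 k3 k4 k5 k6 k7
  have add3 : ∀ {x y z : ℝ}, 0 ≤ x → 0 ≤ y → 0 ≤ z → ¬ (x = 0 ∧ y = 0 ∧ z = 0) →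
      0 < x + y + z := by
    intro x y z hx hy hz h
    refine (add_nonneg (add_nonneg hx hy) hz).lt_of_ne fun h' => h ⟨?_, ?_, ?_⟩ <;> linarith
  have hC := add3 p1 p2 p3 k0
  have hA := add3 p7 p8 p9 k4
  -- nondegeneracy at `y = 0` and at `y = ∞`
  have deg : ∀ {a a' b c c' : ℝ}, 0 ≤ a → 0 ≤ a' → 0 ≤ b → 0 ≤ c → 0 ≤ c' →
      ¬ (c = 0 ∧ a = 0 ∧ b = 0) → ¬ (c = 0 ∧ c' = 0 ∧ b = 0) → ¬ (a = 0 ∧ a' = 0 ∧ b = 0) →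
      0 < b ∨ 0 < a * c ∨ 0 < a * c' + a' * c := by
    intro a a' b c c' ha ha' hb hc hc' h1 h2 h3
    rcases hb.eq_or_lt' with rfl | hb
    · right
      rcases ha.eq_or_lt' with rfl | ha
      · have hc0 : 0 < c := hc.lt_of_ne' fun h => h1 ⟨h, rfl, rfl⟩
        have ha0 : 0 < a' := ha'.lt_of_ne' fun h => h3 ⟨rfl, h, rfl⟩
        right
        positivity
      · rcases hc.eq_or_lt' with rfl | hc
        · have hc0 : 0 < c' := hc'.lt_of_ne' fun h => h2 ⟨rfl, h, rfl⟩
          right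
          positivity
        · left
          positivity
    · exact .inl hb
  have deg0 := deg p7 p8 p4 p1 p2 k2 k1 k3
  have deg1 := deg p9 p8 p6 p3 p2 (fun h => k6 ⟨h.2.1, h.1, h.2.2⟩) k7 k5
  obtain ⟨u, u', huu, hu, hu', hU⟩ := exists_two_roots ht0 ht1 p7 p8 p9 p4 p5 p6 p1 p2 p3
    (by linarith) hA hC deg0
  -- Reversed coefficients: these are roots in the variable y₁/y₀.
  obtain ⟨v, v', hvv, hv, hv', hV⟩ := exists_two_roots ht0 ht1 p9 p8 p7 p6 p5 p4 p3 p2 p1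
    (by linarith) (by linarith) (by linarith) deg1
  obtain ⟨k, hprod⟩ := quartic_eq_prod (e₀ := discrCoeff d t 0) (e₁ := discrCoeff d t 1)
    (e₂ := discrCoeff d t 2) (e₃ := discrCoeff d t 3) (e₄ := discrCoeff d t 4)
    huu hvv hu hu' hv hv'
    (fun y hy => by
      simp [discrCoeff]
      linear_combination hU y hy)
    (fun y hy => by
      simp [discrCoeff]
      linear_combination hV y hy)
  have hF : discr₂ d t = .C (k : ℂ) * (.X 0 - .C (u : ℂ) * .X 1) * (.X 0 - .C (u' : ℂ) * .X 1) *
      (.X 1 - .C (v : ℂ) * .X 0) * (.X 1 - .C (v' : ℂ) * .X 0) :=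
    eq_of_eval_eq fun y₀ y₁ => by
      rw [eval_discr₂ d ht0.ne', hprod]
      simp
  -- The form is positive at [1:1], hence not identically zero.
  have hk0 : (k : ℂ) ≠ 0 := by
    intro hk
    have h1 := hprod 1 1
    rw [hk] at h1
    have h2 : discrCoeff d t 0 + discrCoeff d t 1 + discrCoeff d t 2 + discrCoeff d t 3 +
        discrCoeff d t 4 = 0 := by
      simp at h1
      exact_mod_cast h1
    have h3 := discr_pos_at_one (b := d 0 (-1) + d 0 0 + d 0 1) ht0 ht1 (by linarith)
      (abs_of_pos hA).le (abs_of_nonneg (by positivity)).le (abs_of_pos hC).le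
    refine h3.ne' ?_
    rw [← h2]
    simp [discrCoeff]
    ring
  -- The zeros [u:1] and [1:v] coincide only if uv = 1.
  have hne : ∀ x y : ℝ, |x| < 1 → |y| < 1 → (x : ℂ) * y ≠ 1 := by
    intro x y hx hy h
    have h1 : |x * y| < 1 := by
      rw [abs_mul]
      exact mul_lt_one_of_nonneg_of_lt_one_left (abs_nonneg _) hx hy.le
    have h2 : x * y = 1 := by exact_mod_cast h
    simp [h2] at h1
  rw [IsDoubleZero, hF]
  refine not_sq_dvd_prod hk0 ?_ (by exact_mod_cast huu) (by exact_mod_cast hvv)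
    (hne _ _ hu hv) (hne _ _ hu hv') (hne _ _ hu' hv) (hne _ _ hu' hv')
  by_contra! h
  refine p.rep_nonzero (funext fun i => ?_)
  fin_cases i
  · exact h.1
  · exact h.2

end KernelCurve

theorem lemma2p2 (d : ℤ → ℤ → ℝ) (hd : KernelCurve.IsWeight d)
    (t : ℝ) (ht : t ∈ Set.Ioo (0 : ℝ) 1) (htr : Transcendental (KernelCurve.weightField d) t) :
    ((∃ p, KernelCurve.IsDoubleZero (KernelCurve.discr₂ d t) p) ↔
      KernelCurve.InClosedHalfPlane (KernelCurve.stepSet d)) ∧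
    (KernelCurve.InClosedHalfPlane (KernelCurve.stepSet d) ↔
      ∃ k : Fin 8, KernelCurve.InFamily (KernelCurve.stepSet d) k) := by
  have hiff := KernelCurve.inClosedHalfPlane_iff (S := KernelCurve.stepSet d) fun s hs => hs.1
  refine ⟨?_, hiff⟩
  rw [hiff]
  constructor
  · rintro ⟨p, hp⟩
    by_contra! hk
    exact KernelCurve.not_isDoubleZero_of_not_inFamily hd ht.1 ht.2 hk p hp
  · rintro ⟨k, hk⟩
    exact KernelCurve.exists_isDoubleZero_of_inFamily ht.1.ne' hk
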